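/- All graphs are finite, simple and undirected. For a graph $H$, let $\mathrm{core}(H)$ be the smallest induced subgraph $H'$ of $H$ such that there is a graph homomorphism $H\to H'$ (it is unique up to isomorphism); $H$ is a \emph{core} if $H=\mathrm{core}(H)$. Let $K_7$ and $C_7$ be the complete graph and the cycle on $7$ vertices, let $\overline{C_7}$ be the complement of $C_7$, and let $C_5+2$ be the graph obtained from the $5$-cycle $C_5$ by adding two new vertices that are adjacent to each other and to all vertices of $C_5$. Let $G_1,\dots,G_6$ be the graphs on the vertex set $\{a,b,c,d,e,u,v\}$ whose edges are the five edges $ab,bc,cd,de,ea$ of a $5$-cycle together with the following edges at $u$ and $v$: - $G_1$: $ua,ub,uc$ and $va,vd,ve$; - $G_2$: $ua,ub,uc$ and $va,vc,vd,ve$; - $G_3$: $ua,ub,uc,ud$ and $va,vc,vd,ve$; - $G_4$: $ua,ub,uc$ and $va,vd,ve$ and $uv$; - $G_5$: $ua,ub,ud,ue$ and $va,vc,ve$; - $G_6$: $ua,ub,ud,ue$ and $va,vc,vd,ve$. Then, up to isomorphism, there are exactly $10$ core graphs on $7$ vertices, namely $K_7$, $C_7$, $\overline{C_7}$, $C_5+2$,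 $G_1$, $G_2$, $G_3$, $G_4$, $G_5$, $G_6$. That is, each of these ten graphs is a core, no two of them are isomorphic, and every core on $7$ vertices is isomorphic to one of them. -/

import Mathlib

/-- `IsCoreOf G S`: the subgraph of `G` induced by `S` is a core of `G`, that is, a smallest
(fewest vertices) induced subgraph `H'` of `G` such that `G → H'`. -/
def IsCoreOf {V : Type*} (G : SimpleGraph V) (S : Set V) : Prop :=
  Nonempty (G →g G.induce S) ∧
    ∀ T : Set V, Nonempty (G →g G.induce T) → S.encard ≤ T.encard

/-- A (finite) graph is a core if it is its own core. -/
def IsCoreGraph {V : Type*} (G : SimpleGraph V) : Prop :=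
  IsCoreOf G Set.univ

/-- `G + p`: the graph `G` with `p` universal vertices added, i.e. the disjoint union of `G` and
the clique on `p` vertices together with all edges between the two parts. -/
def addUniversal {V : Type*} (G : SimpleGraph V) (p : ℕ) : SimpleGraph (V ⊕ Fin p) :=
  (G ⊕g (⊤ : SimpleGraph (Fin p))) ⊔ completeBipartiteGraph V (Fin p)

/-- `C₅ + 2`, with its seven vertices relabelled `0, …, 6`. -/
def cycleFivePlusTwo : SimpleGraph (Fin 7) :=
  (addUniversal (SimpleGraph.cycleGraph 5) 2).comap (finSumFinEquiv (m := 5) (n := 2)).symm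

/-- The graph on the vertices `a = 0`, `b = 1`, `c = 2`, `d = 3`, `e = 4`, `u = 5`, `v = 6` whose
edges are those of the 5-cycle `a b c d e` and the pairs in `E`. -/
def pentagonWith (E : Finset (Sym2 (Fin 7))) : SimpleGraph (Fin 7) :=
  SimpleGraph.fromEdgeSet (({s(0, 1), s(1, 2), s(2, 3), s(3, 4), s(4, 0)} ∪ E :
    Finset (Sym2 (Fin 7))) : Set (Sym2 (Fin 7)))

/-- `u ~ a, b, c` and `v ~ a, d, e`. -/
def sporadic1 : SimpleGraph (Fin 7) :=
  pentagonWith {s(5, 0), s(5, 1), s(5, 2), s(6, 0), s(6, 3), s(6, 4)}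

/-- `u ~ a, b, c` and `v ~ a, c, d, e`. -/
def sporadic2 : SimpleGraph (Fin 7) :=
  pentagonWith {s(5, 0), s(5, 1), s(5, 2), s(6, 0), s(6, 2), s(6, 3), s(6, 4)}

/-- `u ~ a, b, c, d` and `v ~ a, c, d, e`. -/
def sporadic3 : SimpleGraph (Fin 7) :=
  pentagonWith {s(5, 0), s(5, 1), s(5, 2), s(5, 3), s(6, 0), s(6, 2), s(6, 3), s(6, 4)}

/-- `u ~ a, b, c`, `v ~ a, d, e` and `u ~ v`. -/
def sporadic4 : SimpleGraph (Fin 7) :=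
  pentagonWith {s(5, 0), s(5, 1), s(5, 2), s(6, 0), s(6, 3), s(6, 4), s(5, 6)}

/-- `u ~ a, b, d, e` and `v ~ a, c, e`. -/
def sporadic5 : SimpleGraph (Fin 7) :=
  pentagonWith {s(5, 0), s(5, 1), s(5, 3), s(5, 4), s(6, 0), s(6, 2), s(6, 4)}

/-- `u ~ a, b, d, e` and `v ~ a, c, d, e`. -/
def sporadic6 : SimpleGraph (Fin 7) :=
  pentagonWith {s(5, 0), s(5, 1), s(5, 3), s(5, 4), s(6, 0), s(6, 2), s(6, 3), s(6, 4)}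

/-- The list `K₇`, `C₇`, complement of `C₇`, `C₅ + 2`, `G₁`, …, `G₆`. -/
def sevenCore : Fin 10 → SimpleGraph (Fin 7) :=
  ![⊤, SimpleGraph.cycleGraph 7, (SimpleGraph.cycleGraph 7)ᶜ, cycleFivePlusTwo,
    sporadic1, sporadic2, sporadic3, sporadic4, sporadic5, sporadic6]

/-!
A finite graph is a core if and only if all its endomorphisms are surjective
(`isCoreGraph_iff_forall_surjective`), and two homomorphically equivalent cores are isomorphic
(`nonempty_iso_of_isCoreGraph`). The classification therefore reduces to three finite facts: the
listed graphs have no homomorphism to six of their vertices (`search_core`), no two of them are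
homomorphically equivalent (`search_pairs`), and every graph on seven vertices with an edge has a
non-surjective endomorphism or is homomorphically equivalent to a listed graph. (A graph with
several vertices and no edge has a constant endomorphism.)

The third fact is checked by a search over the graphs on `0, …, 6` up to a partial symmetry
breaking: if there is a triangle, it is put on `0, 1, 2`, otherwise an edge is put on `0, 1`, and
the remaining vertices are sorted by their neighbourhoods in this clique
(`exists_sorted_labelling`). This leaves 21120 graphs with a triangle (`search_triangle`) and 3259
without (`search_triangleFree`). All but 747 of them have a fold, that is, two vertices
with nested neighbourhoods, and the others are settled by a backtracking search for homomorphisms.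

The searches are evaluated by the kernel. To make this feasible a graph is packed into one natural
number with eight bits for each row of the adjacency matrix, and the backtracking search updates all
candidate sets by a single multiplication and mask (`restrictCandidates`). Its correctness is
`existsHom_eq_true_iff`.
-/

/-! ### Bit-packed graphs and the search functions -/

/-- The number with seven 8-bit fields equal to `1`. In this section a natural number below `2 ^ 56`
is read as seven fields of eight bits, the top bit of each field being spare. The operations on
such numbers are written as `Nat.land`, `Nat.mul`, ..., and the loops through `Nat.rec` and
`Bool.rec`, so that the kernel, which evaluates the former by arithmetic on literals, reaches them
without unfolding type class instances or compiled recursions. -/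
def fieldOnes : ℕ := 282578800148737

/-- The number with seven fields equal to `127`. -/
def fieldMasks : ℕ := 35887507618889599

/-- The number with seven fields equal to `128`, that is, the spare bits. -/
def fieldTops : ℕ := 36170086419038336

/-- `forceNat n f` is `f n`. Inspecting `n` by a recursor makes the kernel evaluate it to a literal
before it is substituted into `f`; otherwise it would be recomputed at each occurrence. -/
noncomputable def forceNat {α : Type} (n : ℕ) (f : ℕ → α) : α :=
  Nat.rec (f 0) (fun m _ => f (Nat.succ m)) n

/-- Whether some `t < n` satisfies `f`, tried downwards until one is found. -/
noncomputable def anyBelow (n : ℕ) (f : ℕ → Bool) : Bool :=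
  Nat.rec false (fun t found => @Bool.rec (fun _ => Bool) found true (f t)) n

/-- Bit `p` of `x`. -/
def hasBit (x p : ℕ) : Bool :=
  Nat.beq (Nat.land (Nat.shiftRight x p) 1) 1

/-- The lower seven bits of field `j` of `x`. -/
def fieldAt (x j : ℕ) : ℕ :=
  Nat.land (Nat.shiftRight x (Nat.mul 8 j)) 127

/-- Whether no field is zero: adding `127` to a field below `128` sets its spare bit exactly if the
field is nonzero. -/
def allFieldsNonzero (x : ℕ) : Bool :=
  Nat.beq (Nat.land (Nat.add x fieldMasks) fieldTops) fieldTops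

/-- The effect of sending vertex `i` to `t` in a search for homomorphisms: field `j` of `x` holds
the set of possible images of vertex `j`, and for each neighbour `j` of `i` in the graph coded by `A`
those that are not neighbours of `t` are removed; `C` codes the non-adjacency of the target. The
neighbours of `i` are marked by ones in the fields of `(A >>> i) &&& fieldOnes`, by symmetry of `A`,
so that one multiplication copies the set to be removed into all their fields. -/
def restrictCandidates (A C i t x : ℕ) : ℕ :=
  Nat.land x (Nat.xor fieldMasks
    (Nat.mul (Nat.land (Nat.shiftRight A i) fieldOnes) (fieldAt C t)))

/-- Backtracking search for a homomorphism with forward checking: the last `k` vertices are still to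
be assigned, in increasing order, and `x` holds their candidate images. -/
noncomputable def searchHom (A C k : ℕ) : ℕ → Bool :=
  Nat.rec (fun _ => true) (fun k search x => anyBelow 7 fun t =>
    hasBit x (Nat.add (Nat.mul 8 (Nat.sub 6 k)) t) &&
      forceNat (restrictCandidates A C (Nat.sub 6 k) t x) fun y =>
        allFieldsNonzero y && search y) k

/-- Whether there is a homomorphism from the graph coded by `A` to the one coded by `B` all of whose
values lie in the set of bits of `m`. -/
noncomputable def existsHom (A B m : ℕ) : Bool :=
  forceNat (Nat.xor fieldMasks B) fun C => searchHom A C 7 (Nat.mul m fieldOnes)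

/-- Whether the neighbourhood of some vertex `i` is contained in that of another vertex. Field `j`
of the number tested holds the neighbours of `i` that are not neighbours of `j`, and a bit is added to
field `i` to exclude `j = i`. -/
noncomputable def hasFold (A : ℕ) : Bool :=
  anyBelow 7 fun i => forceNat (Nat.mul (fieldAt A i) fieldOnes) fun x =>
    !allFieldsNonzero (Nat.lor (Nat.xor x (Nat.land x A)) (Nat.shiftLeft 1 (Nat.mul 8 i)))

/-- The sum of the squares of the degrees, used only to skip comparisons of graphs that are bound to
fail. -/
def degreeSquareSum (A : ℕ) : ℕ :=
  ((List.range 7).map fun i =>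
    ((List.range 7).countP fun j => hasBit A (Nat.add (Nat.mul 8 i) j)) ^ 2).sum

/-- The codes, in the sense of `IsCode`, of the graphs `sevenCore 0`, …, `sevenCore 9`. -/
def coreCodes : List ℕ :=
  [17837855883361662, 9376807296566594, 8461048586795068, 17837830062105970,
   7044885943821682, 8170785854858610, 8179582484751730, 16122453942740338,
   5941113173714290, 8192914061141362]

/-- The seven sets of six vertices, as bit masks. -/
def properMasks : List ℕ := [126, 125, 123, 119, 111, 95, 63]

/-- Whether the graph coded by `A` has an endomorphism that is not surjective or is homomorphically
equivalent to a listed graph. The first two tests, for a fold and for a homomorphism to the first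
three vertices, are special cases of the last one that settle most graphs quickly. -/
noncomputable def noncoreOrListed (A : ℕ) : Bool :=
  hasFold A || existsHom A A 7 ||
  (coreCodes.any fun c => Nat.beq (degreeSquareSum A) (degreeSquareSum c) &&
    existsHom A c 127 && existsHom c A 127) ||
  properMasks.any (existsHom A A)

/-- The codes of all sets of edges from vertex `n` to vertices below `j`, each edge contributing its
two symmetric bits. -/
def rowChoices (n : ℕ) : ℕ → List ℕ
  | 0 => [0]
  | j + 1 => rowChoices n j ++
      (rowChoices n j).map fun x => Nat.lor x (2 ^ (8 * n + j) + 2 ^ (8 * j + n))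

/-- Whether `leaf` holds for all graphs that arise from the graph `A` on the first `n` vertices by
adding `k` vertices one at a time, where an added vertex `n` with edge set `e` to the earlier ones
has to satisfy `ok n A e`. -/
noncomputable def forallExtensions (ok : ℕ → ℕ → ℕ → Bool) (leaf : ℕ → Bool) (k : ℕ) :
    ℕ → ℕ → Bool :=
  Nat.rec (fun _ A => leaf A) (fun _ rest n A => (rowChoices n n).all fun e =>
    !ok n A e || forceNat (Nat.lor A e) fun A' => rest (Nat.succ n) A') k

/-- Whether the set of neighbours of vertex `n` among the first `k` vertices, read as a number, is
at least that of vertex `n - 1`. There is no condition unless both vertices are outside the first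
`k`. -/
def rowsSorted (k n A e : ℕ) : Bool :=
  Nat.ble n k ||
    Nat.ble (Nat.land (fieldAt A (Nat.pred n)) (2 ^ k - 1)) (Nat.land (fieldAt e n) (2 ^ k - 1))

/-- Whether the earlier neighbours of the new vertex `n` are pairwise non-adjacent. -/
noncomputable def rowIndependent (n A e : ℕ) : Bool :=
  !anyBelow n fun j => hasBit e (Nat.add (Nat.mul 8 n) j) &&
    !Nat.beq (Nat.land (fieldAt e n) (fieldAt A j)) 0

/-! ### Bit arithmetic of packed graphs -/

theorem forceNat_eq {α : Type} (n : ℕ) (f : ℕ → α) : forceNat n f = f n := by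
  cases n <;> rfl

theorem anyBelow_eq_true_iff {n : ℕ} {f : ℕ → Bool} :
    anyBelow n f = true ↔ ∃ t < n, f t = true := by
  induction n with
  | zero => exact ⟨fun h => (Bool.false_ne_true h).elim, fun ⟨t, ht, _⟩ => absurd ht (by omega)⟩
  | succ n ih =>
    have h : anyBelow (n + 1) f = (f n || anyBelow n f) := by
      show @Bool.rec (fun _ => Bool) (anyBelow n f) true (f n) = _
      cases f n <;> rfl
    rw [h, Bool.or_eq_true, ih, Nat.exists_lt_succ_right, or_comm]

theorem hasBit_eq_testBit (x p : ℕ) : hasBit x p = x.testBit p := by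
  have h : hasBit x p = Nat.beq (x >>> p &&& 1) 1 := rfl
  rw [h, Nat.testBit_eq_decide_div_mod_eq, Nat.and_one_is_mod, Nat.shiftRight_eq_div_pow,
    Bool.eq_iff_iff]
  simp [Nat.beq_eq]

theorem testBit_fieldAt (x j t : ℕ) :
    (fieldAt x j).testBit t = (x.testBit (8 * j + t) && decide (t < 7)) := by
  have h : fieldAt x j = x >>> (8 * j) &&& (2 ^ 7 - 1) := rfl
  rw [h, Nat.testBit_and, Nat.testBit_shiftRight, Nat.testBit_two_pow_sub_one]

theorem fieldAt_lt (x j : ℕ) : fieldAt x j < 128 :=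
  Nat.lt_succ_of_le (Nat.and_le_right (n := x >>> (8 * j)) (m := 127))

theorem testBit_fieldOnes (p : ℕ) :
    fieldOnes.testBit p = decide (p < 56 ∧ p % 8 = 0) := by
  by_cases hp : p < 56
  · revert p; decide
  · rw [Nat.testBit_lt_two_pow]
    · simp [hp]
    · exact lt_of_lt_of_le (by decide : fieldOnes < 2 ^ 56)
        (Nat.pow_le_pow_right (by simp) (by omega))

theorem testBit_fieldMasks (p : ℕ) :
    fieldMasks.testBit p = decide (p < 56 ∧ p % 8 ≠ 7) := by
  by_cases hp : p < 56
  · revert p; decide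
  · rw [Nat.testBit_lt_two_pow]
    · simp [hp]
    · exact lt_of_lt_of_le (by decide : fieldMasks < 2 ^ 56)
        (Nat.pow_le_pow_right (by simp) (by omega))

theorem testBit_fieldTops (p : ℕ) :
    fieldTops.testBit p = decide (p < 56 ∧ p % 8 = 7) := by
  by_cases hp : p < 56
  · revert p; decide
  · rw [Nat.testBit_lt_two_pow]
    · simp [hp]
    · exact lt_of_lt_of_le (by decide : fieldTops < 2 ^ 56)
        (Nat.pow_le_pow_right (by simp) (by omega))

/-- If all bits of `s` are at positions divisible by `8`, then splitting off the lowest field of `s`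
splits the product `s * b` without a carry. -/
theorem split_low_field {b s : ℕ} (hb : b < 256) (hs : ∀ p, s.testBit p = true → p % 8 = 0) :
    s % 2 ^ 8 ≤ 1 ∧ s * b = 2 ^ 8 * (s / 2 ^ 8 * b) + s % 2 ^ 8 * b ∧ s % 2 ^ 8 * b < 2 ^ 8 := by
  have h0 : s % 2 ^ 8 ≤ 1 := by
    rw [← Nat.lt_succ_iff]
    apply Nat.lt_pow_two_of_testBit (n := 1)
    intro p hp
    rw [Nat.testBit_mod_two_pow]
    by_contra h
    simp only [Bool.and_eq_true, decide_eq_true_eq, Bool.not_eq_false] at h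
    have := hs p h.2
    omega
  refine ⟨h0, ?_, lt_of_le_of_lt (Nat.mul_le_mul_right b h0) (by omega)⟩
  conv_lhs => rw [← Nat.div_add_mod s (2 ^ 8)]
  ring

/-- Multiplication by `b` copies `b` into the fields of `s` that are `1`. -/
theorem testBit_mul_of_sparse {b : ℕ} (hb : b < 256) (j : ℕ) {t : ℕ} (ht : t < 8) :
    ∀ {s : ℕ}, (∀ p, s.testBit p = true → p % 8 = 0) →
      (s * b).testBit (8 * j + t) = (s.testBit (8 * j) && b.testBit t) := by
  induction j with
  | zero =>
    intro s hs
    obtain ⟨h0, h1, h2⟩ := split_low_field hb hs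
    rw [h1, Nat.testBit_two_pow_mul_add _ h2, if_pos (by omega)]
    simp only [Nat.mul_zero, Nat.zero_add, Nat.testBit_zero]
    rcases (by omega : s % 2 ^ 8 = 0 ∨ s % 2 ^ 8 = 1) with h | h
    · rw [h]; simp [show s % 2 = 0 by omega]
    · rw [h]; simp [show s % 2 = 1 by omega]
  | succ j ih =>
    intro s hs
    obtain ⟨h0, h1, h2⟩ := split_low_field hb hs
    rw [h1, Nat.testBit_two_pow_mul_add _ h2, if_neg (by omega),
      show 8 * (j + 1) + t - 8 = 8 * j + t by omega, ih, Nat.testBit_div_two_pow,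
      show 8 * j + 8 = 8 * (j + 1) by ring]
    intro p hp
    rw [Nat.testBit_div_two_pow] at hp
    have := hs _ hp
    omega

theorem testBit_mul_fieldOnes {b : ℕ} (hb : b < 256) {j t : ℕ} (hj : j < 7) (ht : t < 8) :
    (b * fieldOnes).testBit (8 * j + t) = b.testBit t := by
  rw [mul_comm, testBit_mul_of_sparse hb j ht, testBit_fieldOnes]
  · simp [show 8 * j < 56 by omega]
  · intro p hp
    rw [testBit_fieldOnes] at hp
    simpa using (of_decide_eq_true hp).2

theorem testBit_add_masks (n : ℕ) : ∀ (x : ℕ),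
    (∀ j < n, x / 2 ^ (8 * j) % 256 < 128 ∧ x / 2 ^ (8 * j) % 256 ≠ 0) →
      ∀ j < n, (x + ∑ i ∈ Finset.range n, 127 * 2 ^ (8 * i)).testBit (8 * j + 7) = true := by
  induction n with
  | zero => intro _ _ j hj; omega
  | succ n ih =>
    intro x hx j hj
    have h0 := hx 0 (by omega)
    simp only [Nat.mul_zero, pow_zero, Nat.div_one] at h0
    have h1 : x + ∑ i ∈ Finset.range (n + 1), 127 * 2 ^ (8 * i) =
        2 ^ 8 * (x / 2 ^ 8 + ∑ i ∈ Finset.range n, 127 * 2 ^ (8 * i)) + (x % 256 + 127) := by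
      rw [Finset.sum_range_succ', Nat.mul_add, Finset.mul_sum]
      have : ∀ i, 127 * 2 ^ (8 * (i + 1)) = 2 ^ 8 * (127 * 2 ^ (8 * i)) := fun i => by ring
      simp only [this]
      omega
    rw [h1, Nat.testBit_two_pow_mul_add _ (by omega)]
    rcases j with _ | j
    · rw [if_pos (by omega), Nat.testBit_eq_decide_div_mod_eq]
      simp only [Nat.mul_zero, Nat.zero_add, decide_eq_true_eq]
      omega
    · rw [if_neg (by omega), show 8 * (j + 1) + 7 - 8 = 8 * j + 7 by omega]
      apply ih _ _ j (by omega)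
      intro i hi
      have := hx (i + 1) (by omega)
      rwa [show 8 * (i + 1) = 8 + 8 * i by ring, pow_add, ← Nat.div_div_eq_div_mul] at this

theorem allFieldsNonzero_eq_true {x : ℕ} (htop : ∀ j < 7, x.testBit (8 * j + 7) = false)
    (h : ∀ j < 7, ∃ t < 7, x.testBit (8 * j + t) = true) : allFieldsNonzero x = true := by
  have hb : ∀ j t, t < 8 → (x / 2 ^ (8 * j) % 256).testBit t = x.testBit (8 * j + t) := by
    intro j t ht
    rw [show (256 : ℕ) = 2 ^ 8 by rfl, Nat.testBit_mod_two_pow, Nat.testBit_div_two_pow,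
      Nat.add_comm t]
    simp [ht]
  have key := testBit_add_masks 7 x fun j hj => by
    constructor
    · apply Nat.lt_pow_two_of_testBit (n := 7)
      intro p hp
      by_cases h8 : p < 8
      · rw [hb j p h8, show p = 7 by omega, htop j hj]
      · exact Nat.testBit_lt_two_pow (lt_of_lt_of_le (Nat.mod_lt _ (by simp) : _ < 2 ^ 8)
          (Nat.pow_le_pow_right (by simp) (by omega)))
    · intro h0
      obtain ⟨t, ht, hx⟩ := h j hj
      rw [← hb j t (by omega), h0] at hx
      simp at hx
  have hsum : ∑ i ∈ Finset.range 7, 127 * 2 ^ (8 * i) = fieldMasks := by decide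
  rw [hsum] at key
  show Nat.beq ((x + fieldMasks) &&& fieldTops) fieldTops = true
  rw [Nat.beq_eq]
  apply Nat.eq_of_testBit_eq
  intro p
  rw [Nat.testBit_and, testBit_fieldTops]
  by_cases hp : p < 56 ∧ p % 8 = 7
  · have := key (p / 8) (by omega)
    rw [show 8 * (p / 8) + 7 = p by omega] at this
    simp [this]
  · simp [hp]

/-! ### Correctness of the homomorphism search -/

/-- `A` codes the graph `G` on seven vertices: bit `8 * i + j` says whether `i` and `j` are
adjacent. The bits of `A` outside these positions are arbitrary. -/
def IsCode (A : ℕ) (G : SimpleGraph (Fin 7)) : Prop :=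
  ∀ i j : Fin 7, A.testBit (8 * i + j) = true ↔ G.Adj i j

theorem testBit_restrictCandidates (A C i t x : ℕ) {j u : ℕ} (hj : j < 7) (hu : u < 8) :
    (restrictCandidates A C i t x).testBit (8 * j + u) =
      (x.testBit (8 * j + u) && decide (u ≠ 7) &&
        !(A.testBit (8 * j + i) && C.testBit (8 * t + u))) := by
  have h : restrictCandidates A C i t x =
      x &&& (fieldMasks ^^^ (A >>> i &&& fieldOnes) * fieldAt C t) := rfl
  have hC := fieldAt_lt C t
  rw [h, Nat.testBit_and, Nat.testBit_xor, testBit_mul_of_sparse (by omega) j hu,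
    testBit_fieldMasks, testBit_fieldAt, Nat.testBit_and, Nat.testBit_shiftRight,
    testBit_fieldOnes, Nat.add_comm i]
  · have h1 : (8 * j + u) % 8 = u := by omega
    have h2 : 8 * j + u < 56 := by omega
    have h3 : 8 * j < 56 := by omega
    rcases (by omega : u = 7 ∨ u < 7) with rfl | h4
    · simp [h1]
    · simp [h1, h2, h3, h4, show u ≠ 7 by omega]
  · intro p hp
    rw [Nat.testBit_and, testBit_fieldOnes, Bool.and_eq_true, decide_eq_true_eq] at hp
    exact hp.2.2

theorem testBit_xor_fieldMasks (B : ℕ) (t u : Fin 7) :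
    (fieldMasks ^^^ B).testBit (8 * t + u) = !B.testBit (8 * t + u) := by
  rw [Nat.testBit_xor, testBit_fieldMasks, decide_eq_true (by omega)]
  simp

theorem searchHom_succ (A C k x : ℕ) :
    searchHom A C (k + 1) x = true ↔ ∃ t < 7, x.testBit (8 * (6 - k) + t) = true ∧
      allFieldsNonzero (restrictCandidates A C (6 - k) t x) = true ∧
      searchHom A C k (restrictCandidates A C (6 - k) t x) = true := by
  have h : searchHom A C (k + 1) x = anyBelow 7 fun t => hasBit x (8 * (6 - k) + t) &&
      forceNat (restrictCandidates A C (6 - k) t x) fun y =>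
        allFieldsNonzero y && searchHom A C k y := rfl
  simp only [h, anyBelow_eq_true_iff, forceNat_eq, hasBit_eq_testBit, Bool.and_eq_true]

section Search

variable {A B : ℕ} {G H : SimpleGraph (Fin 7)}

theorem exists_partial_hom_of_searchHom (hA : IsCode A G) (hB : IsCode B H) :
    ∀ k ≤ 7, ∀ x, searchHom A (fieldMasks ^^^ B) k x = true →
      ∃ f : Fin 7 → Fin 7, (∀ i : Fin 7, 7 ≤ i + k → x.testBit (8 * i + f i) = true) ∧
        ∀ i j : Fin 7, 7 ≤ i + k → i < j → G.Adj i j → H.Adj (f i) (f j) := by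
  intro k
  induction k with
  | zero => exact fun _ x _ => ⟨id, fun i hi => by omega, fun i j hi => by omega⟩
  | succ k ih =>
    intro hk x hx
    obtain ⟨t, ht, hxt, -, hs⟩ := (searchHom_succ _ _ _ _).1 hx
    obtain ⟨f, hf, hadj⟩ := ih (by omega) _ hs
    obtain ⟨i₀, hi₀⟩ : ∃ i₀ : Fin 7, (i₀ : ℕ) = 6 - k := ⟨⟨6 - k, by omega⟩, rfl⟩
    rw [← hi₀] at hf hxt
    have hf' : ∀ i : Fin 7, 7 ≤ i + k → x.testBit (8 * i + f i) = true ∧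
        (G.Adj i i₀ → H.Adj ⟨t, ht⟩ (f i)) := by
      intro i hi
      have h := hf i hi
      rw [testBit_restrictCandidates _ _ _ _ _ i.2 (by omega),
        testBit_xor_fieldMasks B ⟨t, ht⟩ (f i)] at h
      simp only [Bool.and_eq_true, Bool.not_eq_true',
        ← Bool.not_eq_true, hA i i₀, hB ⟨t, ht⟩ (f i)] at h
      exact ⟨h.1.1, fun h' => by simpa [h', hB ⟨t, ht⟩ (f i)] using h.2⟩
    refine ⟨Function.update f i₀ ⟨t, ht⟩, fun i hi => ?_, fun i j hi hij hG => ?_⟩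
    · by_cases h : i = i₀
      · subst h; simpa using hxt
      · have : (i : ℕ) ≠ i₀ := fun h' => h (Fin.ext h')
        rw [Function.update_of_ne h]
        exact (hf' i (by omega)).1
    · have hj : j ≠ i₀ := by rintro rfl; rw [Fin.lt_def] at hij; omega
      rw [Function.update_of_ne hj]
      rw [Fin.lt_def] at hij
      by_cases h : i = i₀
      · subst h
        rw [Function.update_self]
        exact (hf' j (by omega)).2 hG.symm
      · have : (i : ℕ) ≠ i₀ := fun h' => h (Fin.ext h')
        rw [Function.update_of_ne h]
        exact hadj i j (by omega) hij hG

theorem searchHom_of_hom (hA : IsCode A G) (hB : IsCode B H) (f : G →g H) :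
    ∀ k ≤ 7, ∀ x, (∀ i : Fin 7, x.testBit (8 * i + f i) = true) →
      searchHom A (fieldMasks ^^^ B) k x = true := by
  intro k
  induction k with
  | zero => exact fun _ _ _ => rfl
  | succ k ih =>
    intro hk x hx
    obtain ⟨i₀, hi₀⟩ : ∃ i₀ : Fin 7, (i₀ : ℕ) = 6 - k := ⟨⟨6 - k, by omega⟩, rfl⟩
    rw [searchHom_succ, ← hi₀]
    have hy : ∀ i : Fin 7, (restrictCandidates A (fieldMasks ^^^ B) i₀ (f i₀) x).testBit
        (8 * i + f i) = true := by
      intro i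
      rw [testBit_restrictCandidates _ _ _ _ _ i.2 (by omega), hx,
        testBit_xor_fieldMasks B (f i₀) (f i)]
      have h1 : (f i : ℕ) ≠ 7 := by omega
      by_cases hG : G.Adj i i₀
      · simp [h1, (hB _ _).2 (f.map_adj hG).symm]
      · simp [h1, Bool.eq_false_iff.2 (mt (hA i i₀).1 hG)]
    refine ⟨f i₀, (f i₀).2, hx i₀, allFieldsNonzero_eq_true (fun j hj => ?_) (fun j hj => ?_),
      ih (by omega) _ hy⟩
    · rw [testBit_restrictCandidates _ _ _ _ _ hj (by omega)]
      simp
    · exact ⟨f ⟨j, hj⟩, (f ⟨j, hj⟩).2, hy ⟨j, hj⟩⟩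

theorem existsHom_eq_true_iff (hA : IsCode A G) (hB : IsCode B H) {m : ℕ} (hm : m < 256) :
    existsHom A B m = true ↔ ∃ f : G →g H, ∀ i, m.testBit (f i) = true := by
  have h : existsHom A B m = searchHom A (fieldMasks ^^^ B) 7 (m * fieldOnes) := forceNat_eq _ _
  rw [h]
  constructor
  · intro hs
    obtain ⟨f, hf, hadj⟩ := exists_partial_hom_of_searchHom hA hB 7 le_rfl _ hs
    refine ⟨⟨f, fun {i j} hG => ?_⟩, fun i => ?_⟩
    · rcases lt_or_gt_of_ne hG.ne with hij | hij
      · exact hadj i j (by omega) hij hG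
      · exact (hadj j i (by omega) hij hG.symm).symm
    · rw [← testBit_mul_fieldOnes hm i.2 (by omega)]
      exact hf i (by omega)
  · rintro ⟨f, hf⟩
    refine searchHom_of_hom hA hB f 7 le_rfl _ fun i => ?_
    rw [testBit_mul_fieldOnes hm i.2 (by omega)]
    exact hf i

theorem existsHom_full_iff (hA : IsCode A G) (hB : IsCode B H) :
    existsHom A B 127 = true ↔ Nonempty (G →g H) := by
  rw [existsHom_eq_true_iff hA hB (by omega)]
  exact ⟨fun ⟨f, _⟩ => ⟨f⟩,
    fun ⟨f⟩ => ⟨f, fun i => (by decide : ∀ t : Fin 7, Nat.testBit 127 t = true) _⟩⟩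

theorem exists_properMask (v : Fin 7) :
    ∃ m ∈ properMasks, ∀ t : Fin 7, t ≠ v → m.testBit t = true := by
  revert v; decide

theorem not_testBit_all_of_mem_properMasks {m : ℕ} (hm : m ∈ properMasks) :
    m < 256 ∧ ∃ v : Fin 7, m.testBit v = false := by
  revert m; decide

theorem any_properMasks_iff (hA : IsCode A G) :
    properMasks.any (existsHom A A) = true ↔ ∃ f : G →g G, ¬ Function.Surjective f := by
  rw [List.any_eq_true]
  constructor
  · rintro ⟨m, hm, h⟩
    obtain ⟨hlt, v, hv⟩ := not_testBit_all_of_mem_properMasks hm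
    obtain ⟨f, hf⟩ := (existsHom_eq_true_iff hA hA hlt).1 h
    refine ⟨f, fun hs => ?_⟩
    obtain ⟨i, rfl⟩ := hs v
    simp [hf i] at hv
  · rintro ⟨f, hf⟩
    obtain ⟨v, hv⟩ := not_forall.1 hf
    obtain ⟨m, hm, hmv⟩ := exists_properMask v
    exact ⟨m, hm, (existsHom_eq_true_iff hA hA (not_testBit_all_of_mem_properMasks hm).1).2
      ⟨f, fun i => hmv _ fun h => hv ⟨i, h⟩⟩⟩

/-- If every neighbour of `i` is a neighbour of `j ≠ i`, then moving `i` to `j` and fixing the other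
vertices is an endomorphism that misses `i`. -/
theorem exists_not_surjective_of_hasFold (hA : IsCode A G) (h : hasFold A = true) :
    ∃ f : G →g G, ¬ Function.Surjective f := by
  have h' : hasFold A = anyBelow 7 fun i => forceNat (fieldAt A i * fieldOnes) fun x =>
      !allFieldsNonzero ((x ^^^ (x &&& A)) ||| (1 <<< (8 * i))) := rfl
  rw [h', anyBelow_eq_true_iff] at h
  obtain ⟨i, hi, h⟩ := h
  have hlt := fieldAt_lt A i
  have hbit : ∀ j < 7, ∀ t < 8, ((fieldAt A i * fieldOnes ^^^ (fieldAt A i * fieldOnes &&& A)) |||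
      (1 <<< (8 * i))).testBit (8 * j + t) =
      (((A.testBit (8 * i + t) && decide (t < 7)) && !A.testBit (8 * j + t)) ||
        decide (i = j ∧ t = 0)) := by
    intro j hj t ht
    rw [Nat.testBit_or, Nat.testBit_xor, Nat.testBit_and, testBit_mul_fieldOnes (by omega) hj ht,
      testBit_fieldAt, Nat.one_shiftLeft, Nat.testBit_two_pow]
    congr 1
    · cases A.testBit (8 * i + t) <;> cases A.testBit (8 * j + t) <;> cases decide (t < 7) <;> rfl
    · rw [Bool.eq_iff_iff]
      simp only [decide_eq_true_eq]
      omega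
  rw [forceNat_eq, Bool.not_eq_true', ← Bool.not_eq_true] at h
  have : ∃ j, j < 7 ∧ i ≠ j ∧
      ∀ t < 7, A.testBit (8 * i + t) = true → A.testBit (8 * j + t) = true := by
    -- Otherwise every field of the tested number has a bit: field `i` because of the bit added to
    -- it, and field `j ≠ i` because some neighbour of `i` is not a neighbour of `j`.
    by_contra hcon
    push Not at hcon
    refine h (allFieldsNonzero_eq_true (fun j hj => ?_) fun j hj => ?_)
    · rw [hbit j hj 7 (by omega)]
      simp
    · by_cases hij : i = j
      · exact ⟨0, by omega, by rw [hbit j hj 0 (by omega)]; simp [hij]⟩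
      · obtain ⟨t, ht, h1, h2⟩ := hcon j hj hij
        exact ⟨t, ht, by rw [hbit j hj t (by omega)]; simp [h1, h2, ht]⟩
  obtain ⟨j, hj, hij, hsub⟩ := this
  have hN : ∀ t, G.Adj ⟨i, hi⟩ t → G.Adj ⟨j, hj⟩ t := fun t ht =>
    (hA ⟨j, hj⟩ t).1 (hsub t t.2 ((hA ⟨i, hi⟩ t).2 ht))
  refine ⟨⟨Function.update id ⟨i, hi⟩ ⟨j, hj⟩, fun {a b} hab => ?_⟩, fun hs => ?_⟩
  · by_cases ha : a = ⟨i, hi⟩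
    · have hb : b ≠ ⟨i, hi⟩ := fun hb => hab.ne (ha.trans hb.symm)
      subst ha
      simpa [hb] using hN b hab
    · by_cases hb : b = ⟨i, hi⟩
      · subst hb
        simpa [ha] using (hN a hab.symm).symm
      · simpa [ha, hb] using hab
  · obtain ⟨a, ha⟩ := hs ⟨i, hi⟩
    change Function.update id (⟨i, hi⟩ : Fin 7) ⟨j, hj⟩ a = _ at ha
    by_cases h' : a = ⟨i, hi⟩
    · subst h'
      simp at ha
      exact hij ha.symm
    · rw [Function.update_of_ne h'] at ha
      exact h' ha

end Search

/-! ### Cores and homomorphic equivalence -/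

section Cores

variable {V W : Type*}

theorem isCoreGraph_iff_forall_surjective [Finite V] {G : SimpleGraph V} :
    IsCoreGraph G ↔ ∀ f : G →g G, Function.Surjective f := by
  constructor
  · intro h f
    rw [← Set.range_eq_univ]
    exact Set.Finite.eq_of_subset_of_encard_le' (Set.toFinite _) (Set.subset_univ _)
      (h.2 _ ⟨⟨fun v => ⟨f v, v, rfl⟩, fun hab => f.map_adj hab⟩⟩)
  · intro h
    refine ⟨⟨⟨fun v => ⟨v, trivial⟩, fun hab => hab⟩⟩, fun T ⟨g⟩ => ?_⟩
    have hT : Set.univ ⊆ T := fun v _ => by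
      obtain ⟨w, rfl⟩ := h ((SimpleGraph.Embedding.induce T).toHom.comp g) v
      exact (g w).2
    exact Set.encard_le_encard hT

/-- A bijective endomorphism of a finite graph reflects adjacency, since its inverse is one of its
powers. -/
theorem adj_of_adj_map [Finite V] {G : SimpleGraph V} (f : G →g G) (hf : Function.Bijective f)
    {a b : V} (h : G.Adj (f a) (f b)) : G.Adj a b := by
  have := Fintype.ofFinite V
  let σ : Equiv.Perm V := Equiv.ofBijective f hf
  have hpow : ∀ n : ℕ, ∀ {x y}, G.Adj x y → G.Adj ((σ ^ n) x) ((σ ^ n) y) := by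
    intro n
    induction n with
    | zero => exact fun h => h
    | succ n ih =>
      intro x y hxy
      rw [pow_succ']
      exact f.map_adj (ih hxy)
  have h1 : ∀ x, (σ ^ (orderOf σ - 1)) (f x) = x := by
    intro x
    show (σ ^ (orderOf σ - 1) * σ) x = x
    rw [pow_sub_one_mul (orderOf_pos σ).ne', pow_orderOf_eq_one]
    rfl
  simpa only [h1] using hpow (orderOf σ - 1) h

/-- Homomorphically equivalent finite cores are isomorphic. -/
theorem nonempty_iso_of_isCoreGraph [Finite V] [Finite W] {G : SimpleGraph V} {H : SimpleGraph W}
    (hG : IsCoreGraph G) (hH : IsCoreGraph H) (f : G →g H) (g : H →g G) : Nonempty (G ≃g H) := by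
  rw [isCoreGraph_iff_forall_surjective] at hG hH
  have hgf : Function.Bijective (g.comp f) := Finite.surjective_iff_bijective.1 (hG _)
  have hf : Function.Bijective f :=
    ⟨Function.Injective.of_comp hgf.1, Function.Surjective.of_comp (hH (f.comp g))⟩
  exact ⟨⟨Equiv.ofBijective f hf, fun {a b} =>
    ⟨fun h => adj_of_adj_map _ hgf (g.map_adj h), fun h => f.map_adj h⟩⟩⟩

theorem IsCoreGraph.of_iso [Finite V] [Finite W] {G : SimpleGraph V} {H : SimpleGraph W}
    (hG : IsCoreGraph G) (e : G ≃g H) : IsCoreGraph H := by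
  rw [isCoreGraph_iff_forall_surjective] at hG ⊢
  intro f v
  obtain ⟨w, hw⟩ := hG (e.symm.toHom.comp (f.comp e.toHom)) (e.symm v)
  exact ⟨e w, e.symm.injective hw⟩

theorem IsCoreGraph.exists_adj [Finite V] {G : SimpleGraph V} (hG : IsCoreGraph G)
    (hV : 1 < Nat.card V) : ∃ a b, G.Adj a b := by
  by_contra! h
  have := (Finite.one_lt_card_iff_nontrivial).1 hV
  obtain ⟨v, w, hvw⟩ := exists_pair_ne V
  obtain ⟨u, hu⟩ := isCoreGraph_iff_forall_surjective.1 hG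
    ⟨fun _ => v, fun {a b} hab => absurd hab (h a b)⟩ w
  exact hvw hu

end Cores

/-! ### Codes of the listed graphs -/

theorem getD_mem_coreCodes (i : Fin 10) : coreCodes.getD i 0 ∈ coreCodes := by
  revert i; decide

theorem isCode_cycleFivePlusTwo : IsCode (coreCodes.getD 3 0) cycleFivePlusTwo := by
  intro a b
  obtain ⟨x, rfl⟩ := (finSumFinEquiv (m := 5) (n := 2)).surjective a
  obtain ⟨y, rfl⟩ := (finSumFinEquiv (m := 5) (n := 2)).surjective b
  rw [cycleFivePlusTwo, SimpleGraph.comap_adj, Equiv.symm_apply_apply, Equiv.symm_apply_apply,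
    addUniversal]
  rcases x with x | x <;> rcases y with y | y <;>
    simp only [SimpleGraph.sup_adj, SimpleGraph.sum_adj, SimpleGraph.cycleGraph_adj,
      SimpleGraph.top_adj, completeBipartiteGraph_adj] <;>
    revert x y <;> decide

theorem isCode_sevenCore (i : Fin 10) : IsCode (coreCodes.getD i 0) (sevenCore i) := by
  unfold IsCode
  fin_cases i
  · show ∀ a b : Fin 7, _ ↔ (⊤ : SimpleGraph (Fin 7)).Adj a b
    simp only [SimpleGraph.top_adj]; decide
  · show ∀ a b : Fin 7, _ ↔ (SimpleGraph.cycleGraph 7).Adj a b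
    simp only [SimpleGraph.cycleGraph_adj]; decide
  · show ∀ a b : Fin 7, _ ↔ (SimpleGraph.cycleGraph 7)ᶜ.Adj a b
    simp only [SimpleGraph.compl_adj, SimpleGraph.cycleGraph_adj]; decide
  · exact isCode_cycleFivePlusTwo
  all_goals
    show ∀ a b : Fin 7, _ ↔ (pentagonWith _).Adj a b
    simp only [pentagonWith, SimpleGraph.fromEdgeSet_adj, Finset.mem_coe]
    decide

/-! ### Codes built vertex by vertex -/

/-- The code of the edges from vertex `n` to vertices below `j`, for the adjacency relation `a`. -/
def rowCode (a : ℕ → ℕ → Bool) (n : ℕ) : ℕ → ℕ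
  | 0 => 0
  | j + 1 => if a n j then rowCode a n j ||| (2 ^ (8 * n + j) + 2 ^ (8 * j + n)) else rowCode a n j

/-- The code of the graph that the adjacency relation `a` induces on the first `n` vertices. Only
`a i j` with `j < i` is used. -/
def prefixCode (a : ℕ → ℕ → Bool) : ℕ → ℕ
  | 0 => 0
  | n + 1 => prefixCode a n ||| rowCode a n n

theorem rowCode_congr {a b : ℕ → ℕ → Bool} {n j : ℕ} (h : ∀ i < j, a n i = b n i) :
    rowCode a n j = rowCode b n j := by
  induction j with
  | zero => rfl
  | succ j ih => rw [rowCode, rowCode, ih fun i hi => h i (by omega), h j (by omega)]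

theorem prefixCode_congr {a b : ℕ → ℕ → Bool} {n : ℕ} (h : ∀ i j, j < i → i < n → a i j = b i j) :
    prefixCode a n = prefixCode b n := by
  induction n with
  | zero => rfl
  | succ n ih =>
    rw [prefixCode, prefixCode, ih fun i j hj hi => h i j hj (by omega),
      rowCode_congr fun j hj => h n j hj (by omega)]

theorem rowCode_mem_rowChoices (a : ℕ → ℕ → Bool) (n j : ℕ) : rowCode a n j ∈ rowChoices n j := by
  induction j with
  | zero => simp [rowCode, rowChoices]
  | succ j ih =>
    rw [rowCode, rowChoices, List.mem_append]
    split_ifs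
    · exact Or.inr (List.mem_map_of_mem ih)
    · exact Or.inl ih

/-- A successful exhaustive search applies to every adjacency relation whose rows satisfy the
restriction `ok`. -/
theorem forallExtensions_sound {ok : ℕ → ℕ → ℕ → Bool} {leaf : ℕ → Bool} {a : ℕ → ℕ → Bool}
    (k : ℕ) : ∀ n, forallExtensions ok leaf k n (prefixCode a n) = true →
      (∀ m, n ≤ m → m < n + k → ok m (prefixCode a m) (rowCode a m m) = true) →
      leaf (prefixCode a (n + k)) = true := by
  induction k with
  | zero => exact fun n h _ => h
  | succ k ih =>
    intro n h hok
    have h' : forallExtensions ok leaf (k + 1) n (prefixCode a n) =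
      (rowChoices n n).all fun e => !ok n (prefixCode a n) e ||
        forceNat (prefixCode a n ||| e) fun A' => forallExtensions ok leaf k (n + 1) A' := rfl
    rw [h', List.all_eq_true] at h
    have h1 := h _ (rowCode_mem_rowChoices a n n)
    rw [hok n le_rfl (by omega), forceNat_eq] at h1
    rw [show n + (k + 1) = n + 1 + k by omega]
    exact ih (n + 1) h1 fun m hm hm' => hok m (by omega) (by omega)

theorem testBit_rowCode {a : ℕ → ℕ → Bool} {n j p : ℕ} (hj : j ≤ n) :
    (rowCode a n j).testBit p = true ↔
      ∃ i < j, a n i = true ∧ (p = 8 * n + i ∨ p = 8 * i + n) := by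
  induction j with
  | zero => simp [rowCode]
  | succ j ih =>
    have hpow : (2 ^ (8 * n + j) + 2 ^ (8 * j + n)).testBit p = true ↔
        (p = 8 * n + j ∨ p = 8 * j + n) := by
      rw [show 2 ^ (8 * n + j) = 2 ^ (8 * n + j) * 1 by rw [mul_one],
        Nat.testBit_two_pow_mul_add 1 (Nat.pow_lt_pow_right (by omega) (by omega)),
        Nat.testBit_two_pow]
      split_ifs with hp
      · simp only [decide_eq_true_eq]; omega
      · simp only [Nat.testBit_one_eq_true_iff_self_eq_zero]; omega
    rw [Nat.exists_lt_succ_right, ← ih (by omega), rowCode]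
    split_ifs with ha
    · rw [Nat.testBit_or, Bool.or_eq_true, hpow]; simp [ha]
    · simp [ha]

theorem testBit_prefixCode {a : ℕ → ℕ → Bool} {n p : ℕ} :
    (prefixCode a n).testBit p = true ↔
      ∃ m < n, ∃ i < m, a m i = true ∧ (p = 8 * m + i ∨ p = 8 * i + m) := by
  induction n with
  | zero => simp [prefixCode]
  | succ n ih =>
    rw [prefixCode, Nat.testBit_or, Bool.or_eq_true, ih, testBit_rowCode le_rfl,
      Nat.exists_lt_succ_right]

theorem testBit_rowCode_self {a : ℕ → ℕ → Bool} {n t : ℕ} (hn : n < 8) (ht : t < 8) :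
    (rowCode a n n).testBit (8 * n + t) = true ↔ t < n ∧ a n t = true := by
  rw [testBit_rowCode le_rfl]
  constructor
  · rintro ⟨i, hi, ha, h⟩
    obtain rfl : t = i := by omega
    exact ⟨hi, ha⟩
  · rintro ⟨h, ha⟩
    exact ⟨t, h, ha, Or.inl rfl⟩

theorem testBit_prefixCode_row {a : ℕ → ℕ → Bool} {n m t : ℕ}
    (hn : n ≤ 8) (hm : m < n) (ht : t < n) (hsymm : ∀ i j, a i j = a j i)
    (hirr : ∀ i, a i i = false) :
    (prefixCode a n).testBit (8 * m + t) = true ↔ a m t = true := by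
  rw [testBit_prefixCode]
  constructor
  · rintro ⟨m', hm', i, hi, ha, h | h⟩
    · obtain ⟨rfl, rfl⟩ : m = m' ∧ t = i := by omega
      exact ha
    · obtain ⟨rfl, rfl⟩ : m = i ∧ t = m' := by omega
      rwa [hsymm]
  · intro ha
    rcases lt_trichotomy t m with h | rfl | h
    · exact ⟨m, hm, t, h, ha, Or.inl rfl⟩
    · simp [hirr] at ha
    · exact ⟨t, ht, m, h, by rwa [hsymm], Or.inr rfl⟩

theorem rowsSorted_of_key_le {a : ℕ → ℕ → Bool} {k n : ℕ} (hn : n < 7)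
    (hsymm : ∀ i j, a i j = a j i) (hirr : ∀ i, a i i = false)
    (hkey : k < n →
      Nat.ofBits (fun t : Fin k => a (n - 1) t) ≤ Nat.ofBits (fun t : Fin k => a n t)) :
    rowsSorted k n (prefixCode a n) (rowCode a n n) = true := by
  have h : rowsSorted k n (prefixCode a n) (rowCode a n n) = (Nat.ble n k ||
    Nat.ble (fieldAt (prefixCode a n) (n - 1) &&& (2 ^ k - 1))
      (fieldAt (rowCode a n n) n &&& (2 ^ k - 1))) := rfl
  rw [h, Bool.or_eq_true, Nat.ble_eq, Nat.ble_eq, or_iff_not_imp_left]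
  intro hkn
  have hkn' : k < n := by omega
  convert hkey hkn' using 1
  · apply Nat.eq_of_testBit_eq
    intro t
    rw [Nat.testBit_and, testBit_fieldAt, Nat.testBit_two_pow_sub_one]
    by_cases ht : t < k
    · rw [Nat.testBit_ofBits_lt _ _ ht, Bool.eq_iff_iff]
      simp only [ht, show t < 7 by omega, decide_true, Bool.and_true]
      exact testBit_prefixCode_row (by omega) (by omega) (by omega) hsymm hirr
    · rw [Nat.testBit_ofBits_ge _ _ (by omega)]
      simp [ht]
  · apply Nat.eq_of_testBit_eq
    intro t
    rw [Nat.testBit_and, testBit_fieldAt, Nat.testBit_two_pow_sub_one]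
    by_cases ht : t < k
    · rw [Nat.testBit_ofBits_lt _ _ ht, Bool.eq_iff_iff]
      simp only [ht, show t < 7 by omega, decide_true, Bool.and_true]
      rw [testBit_rowCode_self (by omega) (by omega)]
      exact and_iff_right (by omega)
    · rw [Nat.testBit_ofBits_ge _ _ (by omega)]
      simp [ht]

theorem rowIndependent_of_triangleFree {a : ℕ → ℕ → Bool} {n : ℕ} (hn : n < 7)
    (hsymm : ∀ i j, a i j = a j i) (hirr : ∀ i, a i i = false)
    (htri : ∀ i j k, a i j = true → a j k = true → a i k = true → False) :
    rowIndependent n (prefixCode a n) (rowCode a n n) = true := by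
  have h : rowIndependent n (prefixCode a n) (rowCode a n n) =
    !anyBelow n fun j => hasBit (rowCode a n n) (8 * n + j) &&
      !Nat.beq (fieldAt (rowCode a n n) n &&& fieldAt (prefixCode a n) j) 0 := rfl
  rw [h, Bool.not_eq_true', ← Bool.not_eq_true, anyBelow_eq_true_iff]
  rintro ⟨j, hj, hb⟩
  rw [hasBit_eq_testBit, Bool.and_eq_true, testBit_rowCode_self (by omega) (by omega),
    Bool.not_eq_true', ← Bool.not_eq_true, Nat.beq_eq] at hb
  refine hb.2 (Nat.eq_of_testBit_eq fun t => ?_)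
  rw [Nat.zero_testBit, ← Bool.not_eq_true, Nat.testBit_and, testBit_fieldAt, testBit_fieldAt]
  simp only [Bool.and_eq_true, decide_eq_true_eq]
  rintro ⟨⟨h1, ht⟩, h2, -⟩
  rw [testBit_rowCode_self (by omega) (by omega)] at h1
  rw [testBit_prefixCode_row (by omega) hj (by omega) hsymm hirr] at h2
  exact htri n j t hb.1.2 h2 h1.2

/-! ### Labellings with a clique first and the other vertices sorted -/

section Labelling

/-- An enumeration of part of a finite type extends to one of the whole type in which the remaining
elements are sorted by a given key. -/
theorem exists_equiv_extending_sorted {V : Type*} [Finite V] {k m : ℕ} (hV : Nat.card V = k + m)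
    (c : Fin k ↪ V) (key : V → ℕ) :
    ∃ e : Fin (k + m) ≃ V, (∀ i, e (Fin.castAdd m i) = c i) ∧
      ∀ i j : Fin m, i ≤ j → key (e (Fin.natAdd k i)) ≤ key (e (Fin.natAdd k j)) := by
  classical
  have hcard : Nat.card ↥(Set.range c)ᶜ = m := by
    have h1 := Nat.card_congr (Equiv.Set.sumCompl (Set.range c))
    rw [Nat.card_sum, hV, Nat.card_congr (Equiv.ofInjective c c.injective).symm, Nat.card_fin] at h1
    omega
  let r : Fin m ≃ ↥(Set.range c)ᶜ := (Finite.equivFinOfCardEq hcard).symm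
  let σ := Tuple.sort fun i => key (r i)
  refine ⟨finSumFinEquiv.symm.trans (((Equiv.ofInjective c c.injective).sumCongr (σ.trans r)).trans
    (Equiv.Set.sumCompl _)), fun i => ?_, fun i j hij => ?_⟩
  · simp
  · simpa using Tuple.monotone_sort (fun i => key (r i)) hij

variable {V : Type*} (G : SimpleGraph V) (e : Fin 7 ≃ V)

open Classical in
/-- The adjacency relation of `G` transported along the labelling `e` to the natural numbers below
`7`, and false elsewhere. -/
noncomputable def labelledAdj (i j : ℕ) : Bool :=
  decide (∃ (hi : i < 7) (hj : j < 7), G.Adj (e ⟨i, hi⟩) (e ⟨j, hj⟩))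

theorem labelledAdj_eq_true {i j : ℕ} (hi : i < 7) (hj : j < 7) :
    labelledAdj G e i j = true ↔ G.Adj (e ⟨i, hi⟩) (e ⟨j, hj⟩) := by
  simp [labelledAdj, hi, hj]

theorem labelledAdj_symm (i j : ℕ) : labelledAdj G e i j = labelledAdj G e j i := by
  simp only [labelledAdj, decide_eq_decide]
  exact ⟨fun ⟨h, h', hG⟩ => ⟨h', h, hG.symm⟩, fun ⟨h, h', hG⟩ => ⟨h', h, hG.symm⟩⟩

theorem labelledAdj_self (i : ℕ) : labelledAdj G e i i = false := by
  simp [labelledAdj]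

theorem isCode_prefixCode : IsCode (prefixCode (labelledAdj G e) 7) (G.comap e) := fun i j => by
  rw [testBit_prefixCode_row (by omega) i.2 j.2 (labelledAdj_symm G e) (labelledAdj_self G e),
    labelledAdj_eq_true G e i.2 j.2, SimpleGraph.comap_adj]

end Labelling

/-- A clique of size `k` can be made the first `k` vertices, and the other vertices can be sorted by
their neighbourhoods in it. Hence the searches below, which assume this order, lose no graph. -/
theorem exists_sorted_labelling {V : Type*} [Finite V] (hV : Nat.card V = 7) (G : SimpleGraph V)
    {k : ℕ} (hk : k ≤ 7) (c : Fin k ↪ V) (hc : ∀ i j, i ≠ j → G.Adj (c i) (c j)) :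
    ∃ e : Fin 7 ≃ V,
      prefixCode (labelledAdj G e) k = prefixCode (fun _ _ => true) k ∧
      ∀ n < 7, rowsSorted k n (prefixCode (labelledAdj G e) n)
        (rowCode (labelledAdj G e) n n) = true := by
  classical
  obtain ⟨m, hm⟩ : ∃ m, 7 = k + m := ⟨7 - k, by omega⟩
  obtain ⟨e, hec, hes⟩ := exists_equiv_extending_sorted (hV.trans hm) c
    fun v => Nat.ofBits fun t => decide (G.Adj v (c t))
  let e' : Fin 7 ≃ V := (finCongr hm).trans e
  have hfirst : ∀ i (hi : i < k), e' ⟨i, by omega⟩ = c ⟨i, hi⟩ := fun i hi => hec ⟨i, hi⟩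
  have hlast : ∀ i (hi : i < m), e' ⟨k + i, by omega⟩ = e (Fin.natAdd k ⟨i, hi⟩) :=
    fun i hi => rfl
  have hrow : ∀ i (hi : i < m), (fun t : Fin k => labelledAdj G e' (k + i) t) =
      fun t => decide (G.Adj (e (Fin.natAdd k ⟨i, hi⟩)) (c t)) := fun i hi => by
    funext t
    rw [Bool.eq_iff_iff, labelledAdj_eq_true G e' (by omega) (by omega), hlast i hi,
      hfirst t t.2, decide_eq_true_eq]
  refine ⟨e', prefixCode_congr fun i j hji hi => ?_, fun n hn => ?_⟩
  · rw [labelledAdj_eq_true G e' (by omega) (by omega), hfirst i hi, hfirst j (by omega)]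
    exact hc _ _ fun h => by simp at h; omega
  · refine rowsSorted_of_key_le hn (labelledAdj_symm G e') (labelledAdj_self G e') fun hkn => ?_
    obtain ⟨i, rfl⟩ : ∃ i, n = k + (i + 1) := ⟨n - k - 1, by omega⟩
    rw [show k + (i + 1) - 1 = k + i by omega, hrow i (by omega), hrow (i + 1) (by omega)]
    exact hes _ _ (by simp [Fin.le_def])

/-! ### The exhaustive searches and the classification -/

theorem exists_not_surjective_or_listed {A : ℕ} {G : SimpleGraph (Fin 7)} (hA : IsCode A G)
    (h : noncoreOrListed A = true) :
    (∃ f : G →g G, ¬ Function.Surjective f) ∨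
      ∃ i, Nonempty (G →g sevenCore i) ∧ Nonempty (sevenCore i →g G) := by
  simp only [noncoreOrListed, Bool.or_eq_true] at h
  rcases h with ((h | h) | h) | h
  · exact Or.inl (exists_not_surjective_of_hasFold hA h)
  · obtain ⟨f, hf⟩ := (existsHom_eq_true_iff hA hA (by omega)).1 h
    refine Or.inl ⟨f, fun hs => ?_⟩
    obtain ⟨v, hv⟩ := hs 6
    -- The mask `7` allows the values `0`, `1`, `2` only, so that `6` is missed.
    have := hf v
    rw [hv] at this
    exact absurd this (by decide)
  · obtain ⟨c, hc, h⟩ := List.any_eq_true.1 h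
    obtain ⟨i, rfl⟩ : ∃ i : Fin 10, coreCodes.getD i 0 = c :=
      (by decide : ∀ c ∈ coreCodes, ∃ i : Fin 10, coreCodes.getD i 0 = c) c hc
    simp only [Bool.and_eq_true] at h
    exact Or.inr ⟨i, (existsHom_full_iff hA (isCode_sevenCore i)).1 h.1.2,
      (existsHom_full_iff (isCode_sevenCore i) hA).1 h.2⟩
  · exact Or.inl ((any_properMasks_iff hA).1 h)

/-- The search over the graphs whose first three vertices are a triangle, the others being sorted by
their neighbourhoods in it. -/
theorem search_triangle :
    forallExtensions (rowsSorted 3) noncoreOrListed 4 3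
      (prefixCode (fun _ _ => true) 3) = true := by
  decide +kernel

/-- The search over the triangle-free graphs whose first two vertices are adjacent, the others being
sorted by their neighbourhoods in this edge. -/
theorem search_triangleFree :
    forallExtensions (fun n A e => rowsSorted 2 n A e && rowIndependent n A e) noncoreOrListed 5 2
      (prefixCode (fun _ _ => true) 2) = true := by
  decide +kernel

/-- None of the listed graphs has a homomorphism to six of its vertices. -/
theorem search_core :
    coreCodes.all (fun c => !properMasks.any (existsHom c c)) = true := by
  decide +kernel

/-- No two of the listed graphs are homomorphically equivalent. -/
theorem search_pairs :
    (List.range 10).all (fun i => (List.range i).all fun j =>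
      !(existsHom (coreCodes.getD i 0) (coreCodes.getD j 0) 127 &&
        existsHom (coreCodes.getD j 0) (coreCodes.getD i 0) 127)) = true := by
  decide +kernel

theorem isCoreGraph_sevenCore (i : Fin 10) : IsCoreGraph (sevenCore i) := by
  rw [isCoreGraph_iff_forall_surjective]
  by_contra! h
  have h1 := List.all_eq_true.1 search_core _ (getD_mem_coreCodes i)
  rw [(any_properMasks_iff (isCode_sevenCore i)).2 h] at h1
  exact absurd h1 (by decide)

theorem isEmpty_sevenCore_iso_of_lt {i j : Fin 10} (hij : j < i) :
    IsEmpty (sevenCore i ≃g sevenCore j) := by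
  refine ⟨fun e => ?_⟩
  have h1 := List.all_eq_true.1 (List.all_eq_true.1 search_pairs i (List.mem_range.2 i.2)) j
    (List.mem_range.2 hij)
  rw [(existsHom_full_iff (isCode_sevenCore i) (isCode_sevenCore j)).2 ⟨e.toHom⟩,
    (existsHom_full_iff (isCode_sevenCore j) (isCode_sevenCore i)).2 ⟨e.symm.toHom⟩] at h1
  exact absurd h1 (by decide)

theorem exists_labelling_noncoreOrListed {V : Type*} [Finite V] (hV : Nat.card V = 7)
    (G : SimpleGraph V) {u v : V} (huv : G.Adj u v) :
    ∃ e : Fin 7 ≃ V, noncoreOrListed (prefixCode (labelledAdj G e) 7) = true := by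
  by_cases htri : ∃ a b c, G.Adj a b ∧ G.Adj b c ∧ G.Adj a c
  · obtain ⟨a, b, c, hab, hbc, hac⟩ := htri
    have hadj : ∀ i j : Fin 3, i ≠ j → G.Adj (![a, b, c] i) (![a, b, c] j) := by
      intro i j hij
      fin_cases i <;> fin_cases j <;>
        first | exact absurd rfl hij | assumption | exact SimpleGraph.Adj.symm ‹_›
    obtain ⟨e, hpre, hsort⟩ := exists_sorted_labelling hV G (k := 3) (by omega)
      ⟨![a, b, c], fun i j h => by_contra fun hij => (hadj i j hij).ne h⟩ hadj
    refine ⟨e, forallExtensions_sound (ok := rowsSorted 3) 4 3 ?_ fun m _ hm => hsort m (by omega)⟩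
    rw [hpre]
    exact search_triangle
  · have hadj : ∀ i j : Fin 2, i ≠ j → G.Adj (![u, v] i) (![u, v] j) := by
      intro i j hij
      fin_cases i <;> fin_cases j <;>
        first | exact absurd rfl hij | assumption | exact SimpleGraph.Adj.symm ‹_›
    obtain ⟨e, hpre, hsort⟩ := exists_sorted_labelling hV G (k := 2) (by omega)
      ⟨![u, v], fun i j h => by_contra fun hij => (hadj i j hij).ne h⟩ hadj
    refine ⟨e, forallExtensions_sound
      (ok := fun n A e => rowsSorted 2 n A e && rowIndependent n A e) 5 2 ?_ fun m _ hm => ?_⟩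
    · rw [hpre]
      exact search_triangleFree
    · rw [Bool.and_eq_true]
      refine ⟨hsort m (by omega), rowIndependent_of_triangleFree (by omega)
        (labelledAdj_symm G e) (labelledAdj_self G e) fun i j k hij hjk hik => htri ?_⟩
      simp only [labelledAdj, decide_eq_true_eq] at hij hjk hik
      obtain ⟨_, _, h1⟩ := hij
      obtain ⟨_, _, h2⟩ := hjk
      obtain ⟨_, _, h3⟩ := hik
      exact ⟨_, _, _, h1, h2, h3⟩

/-- The ten listed graphs are cores, they are pairwise non-isomorphic, and every core graph on
seven vertices is isomorphic to one of them. -/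
theorem mainTheorem5 :
    (∀ i : Fin 10, IsCoreGraph (sevenCore i)) ∧
    (∀ i j : Fin 10, i ≠ j → IsEmpty (sevenCore i ≃g sevenCore j)) ∧
    (∀ (V : Type*) (G : SimpleGraph V), Nat.card V = 7 → IsCoreGraph G →
      ∃ i : Fin 10, Nonempty (G ≃g sevenCore i)) := by
  refine ⟨isCoreGraph_sevenCore, fun i j hij => ?_, fun V G hV hG => ?_⟩
  · rcases lt_or_gt_of_ne hij with h | h
    · exact ⟨fun e => (isEmpty_sevenCore_iso_of_lt h).false e.symm⟩
    · exact isEmpty_sevenCore_iso_of_lt h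
  · have : Finite V := Nat.finite_of_card_ne_zero (by omega)
    obtain ⟨u, v, huv⟩ := hG.exists_adj (by omega)
    obtain ⟨e, he⟩ := exists_labelling_noncoreOrListed hV G huv
    let ι : G.comap e ≃g G := SimpleGraph.Iso.comap e G
    have hcore : IsCoreGraph (G.comap e) := hG.of_iso ι.symm
    rcases exists_not_surjective_or_listed (isCode_prefixCode G e) he with ⟨f, hf⟩ | ⟨i, ⟨f⟩, ⟨g⟩⟩
    · exact absurd (isCoreGraph_iff_forall_surjective.1 hcore f) hf
    · obtain ⟨φ⟩ := nonempty_iso_of_isCoreGraph hcore (isCoreGraph_sevenCore i) f g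
      exact ⟨i, ⟨ι.symm.trans φ⟩⟩
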